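/- Let $(G,\Sigma)$ be a signed graph, i.e. a finite simple graph $G$ with a set $\Sigma\subseteq E(G)$ of odd edges (the other edges are even). Let $L(G,\Sigma)=D(G)-A(G,\Sigma)$ be its signed Laplacian matrix, where $D(G)$ is the diagonal matrix of vertex degrees and $A(G,\Sigma)$ has $(i,j)$-entry $1$, $-1$ or $0$ according to whether $i,j$ are joined by an even edge, joined by an odd edge, or not adjacent. Let $v$ and $w$ be distinct non-adjacent vertices of $G$ with degrees $d_1$ and $d_2$, respectively, and suppose that, for some ordering of the vertices starting with $v,w$ and some division of the remaining vertices into five (possibly empty) blocks, $$L(G,\Sigma)=\left[\begin{array}{rr|r|r|r|r|r} d_1 & 0 & -\mathbf 1^t & \mathbf 0^t & -\mathbf 1^t & -\mathbf 1^t & \mathbf 0^t\\ 0 & d_2 & \mathbf 0^t & -\mathbf 1^t & -\mathbf 1^t & \mathbf 1^t & \mathbf 0^t\\\hline -\mathbf 1 & \mathbf 0 & L_{11} & L_{12} & L_{13} & L_{14} & L_{15}\\\hline \mathbf 0 & -\mathbf 1 & L_{21} & L_{22} & L_{23} & L_{24} & L_{25}\\\hline -\mathbf 1 & -\mathbf 1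 & L_{31} & L_{32} & L_{33} & L_{34} & L_{35}\\\hline -\mathbf 1 & \mathbf 1 & L_{41} & L_{42} & L_{43} & L_{44} & L_{45}\\\hline \mathbf 0 & \mathbf 0 & L_{51} & L_{52} & L_{53} & L_{54} & L_{55} \end{array}\right].$$ Suppose moreover that the first three of the five blocks are not all empty. Then spectral integral variation of type 2 occurs under the addition of an odd edge $vw$, i.e. there are real numbers $\lambda_1,\lambda_2$ and a multiset $R$ such that the multisets of eigenvalues of $L(G,\Sigma)$ and of $L(G+vw,\Sigma\cup\{vw\})$ are $\{\lambda_1,\lambda_2\}\uplus R$ and $\{\lambda_1+1,\lambda_2+1\}\uplus R$, respectively, if and only if the following five conditions hold: \begin{align*} L_{11}\mathbf 1+L_{12}\mathbf 1+2L_{13}\mathbf 1&=(d_2+1)\mathbf 1,\\ L_{21}\mathbf 1+L_{22}\mathbf 1+2L_{23}\mathbf 1&=(d_1+1)\mathbf 1,\\ L_{31}\mathbf 1+L_{32}\mathbf 1+2L_{33}\mathbf 1&=(d_1+d_2+2)\mathbf 1,\\ L_{41}\mathbf 1+L_{42}\mathbf 1+2L_{43}\mathbf 1&=-(d_1-d_2)\mathbf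 1,\\ L_{51}\mathbf 1+L_{52}\mathbf 1+2L_{53}\mathbf 1&=\mathbf 0. \end{align*} -/

import Mathlib

/-- A signed graph `(G, Σ)`: a simple graph together with a set of edges of it, the odd edges. -/
structure SignedGraph (V : Type*) where
  /-- the underlying graph `G` -/
  graph : SimpleGraph V
  /-- the sign `Σ`, that is, the set of odd edges -/
  sign : Set (Sym2 V)
  sign_subset : sign ⊆ graph.edgeSet

namespace SignedGraph

variable {V : Type*}

/-- The signed graph obtained by adding the odd edge `vw`. It is meant for (distinct)
non-adjacent vertices `v` and `w`. -/
def addOddEdge (S : SignedGraph V) (v w : V) (hvw : v ≠ w) : SignedGraph V where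
  graph := S.graph ⊔ SimpleGraph.edge v w
  sign := S.sign ∪ {s(v, w)}
  sign_subset := by
    rintro e (he | he)
    · exact SimpleGraph.edgeSet_mono le_sup_left (S.sign_subset he)
    · rw [Set.mem_singleton_iff] at he
      subst he
      simp [hvw]

open Classical in
/-- The adjacency matrix: `1` for an even edge, `-1` for an odd edge, `0` otherwise. -/
noncomputable def adjMatrix (S : SignedGraph V) : Matrix V V ℝ :=
  Matrix.of fun i j => if S.graph.Adj i j then (if s(i, j) ∈ S.sign then -1 else 1) else 0

open Classical in
/-- The degree of a vertex in the underlying graph. -/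
noncomputable def degree [Fintype V] (S : SignedGraph V) (v : V) : ℕ := S.graph.degree v

/-- The signed Laplacian matrix `D(G) - A(G, Σ)`. -/
noncomputable def laplacian [Fintype V] [DecidableEq V] (S : SignedGraph V) : Matrix V V ℝ :=
  Matrix.diagonal (fun i => (S.degree i : ℝ)) - S.adjMatrix

/-- The spectrum: the multiset of eigenvalues of the (real symmetric) signed Laplacian matrix,
with multiplicity. -/
noncomputable def spectrum [Fintype V] [DecidableEq V] (S : SignedGraph V) : Multiset ℝ :=
  S.laplacian.charpoly.roots

/-- Spectral integral variation of type 2 occurs under the addition of the odd edge `vw`: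
two eigenvalues (counted with multiplicity) are increased by `1`, and all the others are kept. -/
def OddEdgeVariationTypeTwo [Fintype V] [DecidableEq V] (S : SignedGraph V) (v w : V)
    (hvw : v ≠ w) : Prop :=
  ∃ (a b : ℝ) (R : Multiset ℝ),
    S.spectrum = a ::ₘ b ::ₘ R ∧
    (S.addOddEdge v w hvw).spectrum = (a + 1) ::ₘ (b + 1) ::ₘ R

end SignedGraph

/-- The two rows, indexed by `v` and `w`, of the off-diagonal part of the centered block form;
the `k`-th column is the constant entry in the `k`-th block. -/
def centeredRows : Matrix (Fin 2) (Fin 5) ℝ :=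
  !![-1,  0, -1, -1, 0;
      0, -1, -1,  1, 0]

/-- The centered block form. The first two rows and columns are indexed by `Fin 2`, the
remaining ones are divided into five (possibly empty) blocks `ι 0, …, ι 4`, and `L i j` is the
block in position `(i, j)`. -/
def centeredMatrix {ι : Fin 5 → Type*} (d₁ d₂ : ℝ) (L : ∀ i j, Matrix (ι i) (ι j) ℝ) :
    Matrix (Fin 2 ⊕ (Σ k, ι k)) (Fin 2 ⊕ (Σ k, ι k)) ℝ :=
  Matrix.fromBlocks
    !![d₁, 0; 0, d₂]
    (Matrix.of fun r q => centeredRows r q.1)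
    (Matrix.of fun p c => centeredRows c p.1)
    (Matrix.of fun p q => L p.1 q.1 p.2 q.2)

/-!
Adding the odd edge `vw` adds the rank-one matrix `u uᵗ` to the signed Laplacian `B`, where
`u = e_v + e_w` has squared length `2` (`SignedGraph.laplacian_addOddEdge`). Two eigenvalues `a`,
`b` go up by `1` while the others are kept exactly when the ratio of the characteristic polynomials,
`1 - uᵗ (x - B)⁻¹ u`, equals `(x - a - 1) (x - b - 1) / ((x - a) (x - b))`. This amounts to
`(B - a) (B - b) u = 0` together with `uᵗ B u = a + b - 1`, if `a` and `b` do not differ by `1`.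

The passage from the spectra to this vector equation
(`Matrix.mulVec_mulVec_eq_of_roots_charpoly_add_vecMulVec`) compares the traces of powers of the two
Laplacians. These give the moments `uᵗ Bᵏ u` for `k ≤ 4`, and hence show that the squared length of
`(B - a) (B - b) u` vanishes. The converse (`Matrix.exists_roots_charpoly_add_vecMulVec`) is the
rank-one determinant lemma at each real `x`; the eigenvalues that go up can be told from the
others as soon as `a` and `b` do not differ by `1`.

In the centered block form `B u` is `(d₁, d₂)` followed by the constants `-1, -1, -2, 0, 0` on the
blocks, so `uᵗ B u = d₁ + d₂` forces `a + b = d₁ + d₂ + 1`. With this value the five blocks of rows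
of `B² u = (a + b) B u - a b u` are the five stated conditions, whatever `a b` is
(`centeredMatrix_mulVec_mulVec_eq_iff`). The rows of `v` and `w` both ask for
`a b = d₁ d₂ + n₄ - n₃`, where `nₖ` is the size of the `k`-th block, because
`d₁ = n₁ + n₃ + n₄` and `d₂ = n₂ + n₃ + n₄`. The resulting quadratic for `a`, `b` has discriminant
`(d₁ - d₂)² + 2 (n₁ + n₂) + 8 n₃ + 1`. It exceeds `1` as one of the first three blocks is not
empty, so `a`, `b` are real and do not differ by `1`.
-/

/-! ### Rank-one updates of symmetric matrices -/

namespace Matrix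

variable {n : Type*} [Fintype n] [DecidableEq n]

/-- The power sums of the eigenvalues of a real symmetric matrix are the traces of its powers. -/
theorem IsHermitian.trace_pow_eq_sum_map_roots {A : Matrix n n ℝ} (hA : A.IsHermitian) (k : ℕ) :
    (A ^ k).trace = (A.charpoly.roots.map (· ^ k)).sum := by
  rw [hA.roots_charpoly_eq_eigenvalues]
  conv_lhs => rw [hA.spectral_theorem, ← map_pow]
  rw [Unitary.conjStarAlgAut_apply, trace_mul_cycle]
  simp [diagonal_pow, trace_diagonal]

/-- A division-free rank-one determinant lemma: when `A` is invertible, `y = q A⁻¹ u` and this is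
`det (A - u vᵗ) = det A * (1 - vᵗ A⁻¹ u)` multiplied by `q`. It is used with `A = x - M` also at
eigenvalues `x` of `M`. -/
theorem det_sub_vecMulVec_mul {R : Type*} [CommRing R] (A : Matrix n n R) (u v y : n → R) (q : R)
    (hy : A *ᵥ y = q • u) :
    (A - vecMulVec u v).det * q = A.det * (q - v ⬝ᵥ y) := by
  have h : fromBlocks A (replicateCol Unit u) (replicateRow Unit v) 1 *
      fromBlocks 1 (-replicateCol Unit y) 0 (diagonal fun _ => q) =
      fromBlocks A 0 (replicateRow Unit v) (diagonal fun _ => q - v ⬝ᵥ y) := by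
    rw [fromBlocks_multiply]
    congr 1
    · simp
    · ext i j
      have := congrFun hy i
      simp only [mulVec, Pi.smul_apply, smul_eq_mul] at this
      simp [mul_apply, dotProduct, mul_comm] at this ⊢
      linear_combination -this
    · simp
    · ext i j
      simp [mul_apply, dotProduct]
      ring
  have := congrArg det h
  rw [det_mul, det_fromBlocks_one₂₂, det_fromBlocks_zero₂₁, det_fromBlocks_zero₁₂] at this
  simpa [vecMulVec_eq Unit] using this

theorem sq_add_vecMulVec_self {A : Matrix n n ℝ} (hA : Aᵀ = A) (u : n → ℝ) (hu : u ⬝ᵥ u = 2) :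
    (A + vecMulVec u u) ^ 2 = A ^ 2 + vecMulVec (A *ᵥ u) u + vecMulVec u (A *ᵥ u)
      + (2 : ℝ) • vecMulVec u u := by
  rw [pow_two, add_mul, mul_add, mul_add, vecMulVec_mul_vecMulVec, mul_vecMulVec, vecMulVec_mul,
    hu, ← mulVec_transpose, hA, pow_two, vecMulVec_smul]
  abel

/-- For `u` of squared length `2`, the traces of the powers of `A + u uᵗ` up to the fifth, in terms
of those of `A` and of the moments `uᵗ Aᵏ u`; the moments `m₃`, `m₄` are written symmetrically. -/
theorem trace_pow_add_vecMulVec_self {A : Matrix n n ℝ} (hA : Aᵀ = A) (u : n → ℝ)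
    (hu : u ⬝ᵥ u = 2) (m₁ m₂ m₃ m₄ : ℝ)
    (h1 : u ⬝ᵥ A *ᵥ u = m₁) (h2 : u ⬝ᵥ A *ᵥ A *ᵥ u = m₂)
    (h3 : A *ᵥ u ⬝ᵥ A *ᵥ A *ᵥ u = m₃) (h4 : A *ᵥ A *ᵥ u ⬝ᵥ A *ᵥ A *ᵥ u = m₄) :
    ((A + vecMulVec u u) ^ 2).trace = (A ^ 2).trace + 2 * m₁ + 4 ∧
    ((A + vecMulVec u u) ^ 3).trace = (A ^ 3).trace + 3 * m₂ + 6 * m₁ + 8 ∧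
    ((A + vecMulVec u u) ^ 4).trace = (A ^ 4).trace + 4 * m₃ + 8 * m₂ + 2 * m₁ ^ 2 + 16 * m₁ + 16 ∧
    ((A + vecMulVec u u) ^ 5).trace = (A ^ 5).trace + 5 * m₄ + 10 * m₃ + 5 * m₁ * m₂ + 20 * m₂
      + 10 * m₁ ^ 2 + 40 * m₁ + 32 := by
  have hsymm (x y : n → ℝ) : A *ᵥ x ⬝ᵥ y = x ⬝ᵥ A *ᵥ y := by
    rw [dotProduct_mulVec, ← mulVec_transpose, hA]
  have hv (x : n → ℝ) : x ᵥ* A = A *ᵥ x := by rw [← mulVec_transpose, hA]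
  have h3' : u ⬝ᵥ A *ᵥ A *ᵥ A *ᵥ u = m₃ := by rw [← h3, hsymm]
  have h4' : u ⬝ᵥ A *ᵥ A *ᵥ A *ᵥ A *ᵥ u = m₄ := by rw [← h4, hsymm, hsymm]
  have e2 := sq_add_vecMulVec_self hA u hu
  have e3 : (A + vecMulVec u u) ^ 3 = A ^ 3 + vecMulVec (A *ᵥ A *ᵥ u) u
      + vecMulVec (A *ᵥ u) (A *ᵥ u) + vecMulVec u (A *ᵥ A *ᵥ u)
      + (2 : ℝ) • vecMulVec (A *ᵥ u) u + (2 : ℝ) • vecMulVec u (A *ᵥ u)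
      + (m₁ + 4) • vecMulVec u u := by
    rw [pow_succ, e2, pow_succ A 2]
    simp only [add_mul, mul_add, smul_mul_assoc, mul_vecMulVec, vecMulVec_mul, vecMulVec_mulVec,
      op_smul_eq_smul, smul_vecMulVec, hsymm, hv, hu, h1, pow_two A, ← mulVec_mulVec]
    module
  have e4 : (A + vecMulVec u u) ^ 4 = (A + vecMulVec u u) ^ 2 * (A + vecMulVec u u) ^ 2 := by
    rw [← pow_add]
  have e5 : (A + vecMulVec u u) ^ 5 = (A + vecMulVec u u) ^ 2 * (A + vecMulVec u u) ^ 3 := by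
    rw [← pow_add]
  refine ⟨?_, ?_, ?_, ?_⟩
  · rw [e2]
    simp only [trace_add, trace_smul, trace_vecMulVec, smul_eq_mul, hsymm, h1, hu]
    ring
  · rw [e3]
    simp only [trace_add, trace_smul, trace_vecMulVec, smul_eq_mul, hsymm, h1, h2, hu]
    ring
  · rw [e4, e2, show A ^ 4 = A ^ 2 * A ^ 2 by rw [← pow_add]]
    simp only [add_mul, mul_add, trace_add, smul_mul_assoc, mul_smul_comm, trace_smul,
      mul_vecMulVec, vecMulVec_mul, trace_vecMulVec, vecMulVec_mulVec, op_smul_eq_smul,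
      smul_dotProduct, hsymm, pow_two A, ← mulVec_mulVec, ← vecMul_vecMul, hv, h1, h2, h3', hu,
      smul_eq_mul]
    ring
  · rw [e5, e3, e2, show A ^ 5 = A ^ 2 * A ^ 3 by rw [← pow_add]]
    simp only [add_mul, mul_add, trace_add, smul_mul_assoc, mul_smul_comm, trace_smul,
      mul_vecMulVec, vecMulVec_mul, trace_vecMulVec, vecMulVec_mulVec, op_smul_eq_smul,
      smul_dotProduct, hsymm, pow_two A, pow_succ A 2, ← mulVec_mulVec, ← vecMul_vecMul, hv,
      h1, h2, h3', h4', hu, smul_eq_mul]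
    ring

/-- If adding `u uᵗ` (with `uᵗ u = 2`) raises two eigenvalues `a`, `b` by `1` and keeps the others,
then `u` is annihilated by `(A - a) (A - b)`. No case distinction on coincidences between `a`, `b`,
`a + 1`, `b + 1` is needed: the traces of the second to fifth powers determine the moments
`mₖ = uᵗ Aᵏ u`, `1 ≤ k ≤ 4`, and these satisfy `mₖ₊₂ = (a + b) mₖ₊₁ - a b mₖ`, whence
`‖(A - a) (A - b) u‖ ^ 2 = 0`. -/
theorem mulVec_mulVec_eq_of_roots_charpoly_add_vecMulVec {A : Matrix n n ℝ} (hA : Aᵀ = A)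
    (u : n → ℝ) (hu : u ⬝ᵥ u = 2) (a b : ℝ) (R : Multiset ℝ) (h : A.charpoly.roots = a ::ₘ b ::ₘ R)
    (h' : (A + vecMulVec u u).charpoly.roots = (a + 1) ::ₘ (b + 1) ::ₘ R) :
    A *ᵥ A *ᵥ u = (a + b) • A *ᵥ u - (a * b) • u ∧ u ⬝ᵥ A *ᵥ u = a + b - 1 := by
  have hAh : A.IsHermitian := by rw [IsHermitian, conjTranspose_eq_transpose_of_trivial, hA]
  have hBh : (A + vecMulVec u u).IsHermitian := by
    rw [IsHermitian, conjTranspose_eq_transpose_of_trivial, transpose_add, hA, transpose_vecMulVec]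
  have hsymm (x y : n → ℝ) : A *ᵥ x ⬝ᵥ y = x ⬝ᵥ A *ᵥ y := by
    rw [dotProduct_mulVec, ← mulVec_transpose, hA]
  obtain ⟨t2, t3, t4, t5⟩ := trace_pow_add_vecMulVec_self hA u hu _ _ _ _ rfl rfl rfl rfl
  have key (k : ℕ) : ((A + vecMulVec u u) ^ k).trace
      = (A ^ k).trace + ((a + 1) ^ k - a ^ k + ((b + 1) ^ k - b ^ k)) := by
    rw [hAh.trace_pow_eq_sum_map_roots, hBh.trace_pow_eq_sum_map_roots, h, h']
    simp only [Multiset.map_cons, Multiset.sum_cons]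
    ring
  rw [key] at t2 t3 t4 t5
  generalize hm1 : u ⬝ᵥ A *ᵥ u = m₁ at *
  generalize hm2 : u ⬝ᵥ A *ᵥ A *ᵥ u = m₂ at *
  generalize hm3 : A *ᵥ u ⬝ᵥ A *ᵥ A *ᵥ u = m₃ at *
  generalize hm4 : A *ᵥ A *ᵥ u ⬝ᵥ A *ᵥ A *ᵥ u = m₄ at *
  -- each power sum, the lower moments being known, is a linear equation for the next moment
  have r1 : m₁ = a + b - 1 := by linarith
  have r2 : m₂ = (a + b) * m₁ - a * b * 2 := by subst r1; linarith
  have r3 : m₃ = (a + b) * m₂ - a * b * m₁ := by subst r2; subst r1; linarith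
  have r4 : m₄ = (a + b) * m₃ - a * b * m₂ := by subst r3; subst r2; subst r1; linarith
  refine ⟨?_, r1⟩
  rw [← sub_eq_zero, ← dotProduct_self_eq_zero]
  simp only [sub_dotProduct, dotProduct_sub, smul_dotProduct, dotProduct_smul, smul_eq_mul]
  rw [dotProduct_comm (A *ᵥ A *ᵥ u) (A *ᵥ u), hm3, hm4, dotProduct_comm (A *ᵥ A *ᵥ u) u, hm2,
    hsymm u (A *ᵥ u), hm2, hsymm u u, hm1, hu]
  subst r4; subst r3; subst r2
  ring

/-- Conversely, if `u` is annihilated by `(A - a) (A - b)` and has the right first moment, then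
`a` and `b` are eigenvalues of `A`, and adding `u uᵗ` raises them by `1` and keeps the others.
The hypotheses `a ≠ b + 1` and `b ≠ a + 1` exclude that a new eigenvalue coincides with an old one:
for `b = a + 1` the vector `u` may be an eigenvector for `a`, and then `a` alone is raised,
by `2`. -/
theorem exists_roots_charpoly_add_vecMulVec {A : Matrix n n ℝ} (u : n → ℝ) (hu : u ⬝ᵥ u = 2)
    (a b : ℝ) (hab : a ≠ b + 1) (hba : b ≠ a + 1)
    (h : A *ᵥ A *ᵥ u = (a + b) • A *ᵥ u - (a * b) • u) (h1 : u ⬝ᵥ A *ᵥ u = a + b - 1) :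
    ∃ R : Multiset ℝ, A.charpoly.roots = a ::ₘ b ::ₘ R ∧
      (A + vecMulVec u u).charpoly.roots = (a + 1) ::ₘ (b + 1) ::ₘ R := by
  open Polynomial in
  have hpoly : (A + vecMulVec u u).charpoly * ((X - C a) * (X - C b)) =
      A.charpoly * ((X - C (a + 1)) * (X - C (b + 1))) := by
    refine Polynomial.funext fun x => ?_
    -- `(x - A) (x + A - (a + b)) u = (x - a) (x - b) u`, since `(A - a) (A - b) u = 0`
    have hy : (scalar n x - A) *ᵥ (A *ᵥ u + (x - (a + b)) • u) = ((x - a) * (x - b)) • u := by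
      rw [sub_mulVec, mulVec_add A, mulVec_smul A, h]
      ext i
      simp only [scalar_apply, mulVec_diagonal, Pi.add_apply, Pi.sub_apply, Pi.smul_apply,
        smul_eq_mul]
      ring
    have := det_sub_vecMulVec_mul _ u u _ _ hy
    simp only [eval_mul, eval_sub, eval_X, eval_C, eval_charpoly, ← sub_sub]
    rw [this, dotProduct_add, dotProduct_smul, hu, h1, smul_eq_mul]
    ring
  have hroots := congrArg Polynomial.roots hpoly
  have hq (c d : ℝ) : (Polynomial.X - Polynomial.C c) * (Polynomial.X - Polynomial.C d) ≠ 0 :=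
    mul_ne_zero (Polynomial.X_sub_C_ne_zero c) (Polynomial.X_sub_C_ne_zero d)
  rw [Polynomial.roots_mul (mul_ne_zero (charpoly_monic _).ne_zero (hq _ _)),
    Polynomial.roots_mul (mul_ne_zero (charpoly_monic _).ne_zero (hq _ _)),
    Polynomial.roots_mul (hq _ _), Polynomial.roots_mul (hq _ _)] at hroots
  simp only [Polynomial.roots_X_sub_C] at hroots
  -- `a` and `b` are roots on the right of `hroots` but neither is `a + 1` or `b + 1`
  have hle : ({a} + {b} : Multiset ℝ) ≤ A.charpoly.roots := by
    rw [Multiset.le_iff_count]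
    intro c
    have hc := congrArg (Multiset.count c) hroots
    simp only [Multiset.count_add, Multiset.count_singleton] at hc ⊢
    by_cases ha : c = a
    · subst ha
      simp [hab] at hc ⊢
      omega
    · by_cases hb : c = b
      · subst hb
        simp [hba] at hc ⊢
        omega
      · simp [ha, hb]
  obtain ⟨R, hR⟩ := Multiset.le_iff_exists_add.1 hle
  refine ⟨R, by simpa using hR, ?_⟩
  rw [hR] at hroots
  have : (A + vecMulVec u u).charpoly.roots = {a + 1} + {b + 1} + R := by
    refine add_right_cancel (b := ({a} + {b} : Multiset ℝ)) ?_
    rw [hroots]; abel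
  simpa using this

end Matrix

/-! ### The signed Laplacian -/

namespace SignedGraph

open Matrix

variable {V : Type*}

theorem adjMatrix_apply_self (S : SignedGraph V) (i : V) : S.adjMatrix i i = 0 := by
  simp [adjMatrix]

theorem sum_adjMatrix_sq [Fintype V] (S : SignedGraph V) (i : V) :
    ∑ j, S.adjMatrix i j ^ 2 = S.degree i := by
  classical
  have h (j : V) : S.adjMatrix i j ^ 2 = if S.graph.Adj i j then 1 else 0 := by
    simp only [adjMatrix, of_apply]
    split_ifs <;> norm_num
  simp only [h, Finset.sum_boole, degree, ← SimpleGraph.card_neighborFinset_eq_degree,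
    SimpleGraph.neighborFinset_eq_filter]

theorem adjMatrix_addOddEdge [DecidableEq V] (S : SignedGraph V) {v w : V} (hvw : v ≠ w)
    (h : ¬ S.graph.Adj v w) (i j : V) :
    (S.addOddEdge v w hvw).adjMatrix i j =
      S.adjMatrix i j - if s(i, j) = s(v, w) then 1 else 0 := by
  have hadj : (S.addOddEdge v w hvw).graph.Adj i j ↔ S.graph.Adj i j ∨ s(i, j) = s(v, w) := by
    simp only [addOddEdge, SimpleGraph.sup_adj, SimpleGraph.edge_adj, Sym2.eq_iff]
    grind
  have hsign : s(i, j) ∈ (S.addOddEdge v w hvw).sign ↔ s(i, j) ∈ S.sign ∨ s(i, j) = s(v, w) :=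
    Iff.rfl
  classical
  simp only [adjMatrix, of_apply]
  rw [if_congr hadj (if_congr hsign rfl rfl) rfl]
  by_cases hij : s(i, j) = s(v, w)
  · have h1 : ¬ S.graph.Adj i j := by
      rwa [← SimpleGraph.mem_edgeSet, hij, SimpleGraph.mem_edgeSet]
    simp [h1, hij]
  · simp [hij]

variable [Fintype V] [DecidableEq V]

/-- The row sums of squares of the Laplacian recover the degrees; in the centered block form they
count the neighbours of `v` and `w` by blocks. -/
theorem sum_laplacian_sq (S : SignedGraph V) (i : V) :
    ∑ j, S.laplacian i j ^ 2 = (S.degree i : ℝ) ^ 2 + S.degree i := by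
  have h (j : V) : S.laplacian i j ^ 2 =
      (if i = j then (S.degree i : ℝ) ^ 2 else 0) + S.adjMatrix i j ^ 2 := by
    rw [laplacian, Matrix.sub_apply, diagonal_apply]
    split_ifs with hij
    · subst hij
      rw [adjMatrix_apply_self]
      ring
    · ring
  simp only [h, Finset.sum_add_distrib, sum_adjMatrix_sq, Finset.sum_ite_eq, Finset.mem_univ,
    if_true]

theorem laplacian_transpose (S : SignedGraph V) : S.laplacianᵀ = S.laplacian := by
  have h : S.adjMatrixᵀ = S.adjMatrix := by
    ext i j
    classical
    exact if_congr (S.graph.adj_comm j i) (if_congr (by rw [Sym2.eq_swap]) rfl rfl) rfl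
  rw [laplacian, transpose_sub, diagonal_transpose, h]

theorem degree_addOddEdge (S : SignedGraph V) {v w : V} (hvw : v ≠ w)
    (h : ¬ S.graph.Adj v w) (i : V) :
    ((S.addOddEdge v w hvw).degree i : ℝ) = S.degree i + if i = v ∨ i = w then 1 else 0 := by
  have h0 : S.adjMatrix v w = 0 := by simp [adjMatrix, h]
  have h0' : S.adjMatrix w v = 0 := by simp [adjMatrix, S.graph.adj_comm w v, h]
  have key (j : V) : (S.addOddEdge v w hvw).adjMatrix i j ^ 2 =
      S.adjMatrix i j ^ 2 + if s(i, j) = s(v, w) then 1 else 0 := by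
    rw [S.adjMatrix_addOddEdge hvw h]
    split_ifs with hij
    · rw [Sym2.eq_iff] at hij
      obtain ⟨rfl, rfl⟩ | ⟨rfl, rfl⟩ := hij
      · simp [h0]
      · simp [h0']
    · ring
  rw [← sum_adjMatrix_sq, ← sum_adjMatrix_sq]
  simp only [key, Finset.sum_add_distrib]
  congr 1
  by_cases hv : i = v
  · subst hv
    simp [hvw]
  · by_cases hw : i = w
    · subst hw
      simp [hv]
    · simp [hv, hw]

/-- Adding an odd edge `vw` adds `u uᵗ` to the Laplacian, `u` being the indicator vector of
`{v, w}`. -/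
theorem laplacian_addOddEdge (S : SignedGraph V) {v w : V} (hvw : v ≠ w)
    (h : ¬ S.graph.Adj v w) :
    (S.addOddEdge v w hvw).laplacian = S.laplacian +
      vecMulVec (fun i => if i = v ∨ i = w then 1 else 0)
        (fun i => if i = v ∨ i = w then 1 else 0) := by
  ext i j
  simp only [laplacian, Matrix.sub_apply, Matrix.add_apply, diagonal_apply, vecMulVec_apply,
    S.degree_addOddEdge hvw h, S.adjMatrix_addOddEdge hvw h, Sym2.eq_iff]
  grind

end SignedGraph

/-! ### The centered block form -/

section Centered

open Matrix

variable {ι : Fin 5 → Type*} [∀ k, Fintype (ι k)]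

theorem centeredMatrix_mulVec (d₁ d₂ : ℝ) (L : ∀ i j, Matrix (ι i) (ι j) ℝ) :
    centeredMatrix d₁ d₂ L *ᵥ Sum.elim 1 0 =
      Sum.elim ![d₁, d₂] (fun p => ![-1, -1, -2, 0, 0] p.1) := by
  rw [centeredMatrix, fromBlocks_mulVec]
  ext (r | ⟨k, i⟩)
  · fin_cases r <;> simp [dotProduct, Fin.sum_univ_two]
  · fin_cases k <;> norm_num [mulVec, dotProduct, Fin.sum_univ_two, centeredRows]

/-- The equation `B² u = (d₁ + d₂ + 1) B u - p u` for `u = e_v + e_w`, read off block by block: the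
rows of the five blocks give the five conditions, and the rows of `v` and `w` determine `p`. -/
theorem centeredMatrix_mulVec_mulVec_eq_iff (d₁ d₂ p : ℝ) (L : ∀ i j, Matrix (ι i) (ι j) ℝ) :
    centeredMatrix d₁ d₂ L *ᵥ centeredMatrix d₁ d₂ L *ᵥ Sum.elim 1 0 =
        (d₁ + d₂ + 1) • centeredMatrix d₁ d₂ L *ᵥ Sum.elim 1 0 -
          p • (Sum.elim 1 0 : Fin 2 ⊕ (Σ k, ι k) → ℝ) ↔
      (d₁ * d₁ + Fintype.card (ι 0) + 2 * Fintype.card (ι 2) = (d₁ + d₂ + 1) * d₁ - p ∧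
        d₂ * d₂ + Fintype.card (ι 1) + 2 * Fintype.card (ι 2) = (d₁ + d₂ + 1) * d₂ - p) ∧
      L 0 0 *ᵥ 1 + L 0 1 *ᵥ 1 + (2 : ℝ) • L 0 2 *ᵥ 1 = (d₂ + 1) • (1 : ι 0 → ℝ) ∧
      L 1 0 *ᵥ 1 + L 1 1 *ᵥ 1 + (2 : ℝ) • L 1 2 *ᵥ 1 = (d₁ + 1) • (1 : ι 1 → ℝ) ∧
      L 2 0 *ᵥ 1 + L 2 1 *ᵥ 1 + (2 : ℝ) • L 2 2 *ᵥ 1 = (d₁ + d₂ + 2) • (1 : ι 2 → ℝ) ∧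
      L 3 0 *ᵥ 1 + L 3 1 *ᵥ 1 + (2 : ℝ) • L 3 2 *ᵥ 1 = (-(d₁ - d₂)) • (1 : ι 3 → ℝ) ∧
      L 4 0 *ᵥ 1 + L 4 1 *ᵥ 1 + (2 : ℝ) • L 4 2 *ᵥ 1 = (0 : ι 4 → ℝ) := by
  have hblock (k : Fin 5) (i : ι k) :
      (centeredMatrix d₁ d₂ L *ᵥ Sum.elim ![d₁, d₂] (fun p => ![-1, -1, -2, 0, 0] p.1))
        (Sum.inr ⟨k, i⟩) = centeredRows 0 k * d₁ + centeredRows 1 k * d₂ -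
        (L k 0 *ᵥ 1 + L k 1 *ᵥ 1 + (2 : ℝ) • L k 2 *ᵥ 1) i := by
    rw [centeredMatrix, fromBlocks_mulVec]
    simp [mulVec, dotProduct, Fintype.sum_sigma, Fin.sum_univ_five, ← Finset.sum_mul,
      vecHead, vecTail]
    ring
  rw [centeredMatrix_mulVec, funext_iff, Sum.forall, Fin.forall_fin_two, Sigma.forall]
  have hfive (P : Fin 5 → Prop) : (∀ k, P k) ↔ P 0 ∧ P 1 ∧ P 2 ∧ P 3 ∧ P 4 := by
    simp [Fin.forall_fin_succ]
  rw [hfive]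
  simp only [hblock, funext_iff]
  refine and_congr (and_congr ?_ ?_) (and_congr (forall_congr' fun i => ?_)
    (and_congr (forall_congr' fun i => ?_) (and_congr (forall_congr' fun i => ?_)
    (and_congr (forall_congr' fun i => ?_) (forall_congr' fun i => ?_)))))
  · rw [centeredMatrix, fromBlocks_mulVec]
    simp [mulVec, dotProduct, Fintype.sum_sigma, Fin.sum_univ_five, centeredRows]
    constructor <;> intro h <;> linarith
  · rw [centeredMatrix, fromBlocks_mulVec]
    simp [mulVec, dotProduct, Fintype.sum_sigma, Fin.sum_univ_five, centeredRows]
    constructor <;> intro h <;> linarith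
  all_goals
    simp [centeredRows]
    constructor <;> intro h <;> linarith

end Centered

/-! ### Spectral integral variation of type two -/

open Matrix

theorem mainTheorem4 {V : Type*} [Fintype V] [DecidableEq V] (S : SignedGraph V) (v w : V)
    (hvw : v ≠ w) (hnonadj : ¬ S.graph.Adj v w)
    (d₁ d₂ : ℕ) (hd₁ : S.degree v = d₁) (hd₂ : S.degree w = d₂)
    {ι : Fin 5 → Type*} [∀ k, Fintype (ι k)]
    (e : V ≃ Fin 2 ⊕ (Σ k, ι k)) (hv : e v = Sum.inl 0) (hw : e w = Sum.inl 1)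
    (L : ∀ i j, Matrix (ι i) (ι j) ℝ)
    (hL : Matrix.reindex e e S.laplacian = centeredMatrix (d₁ : ℝ) (d₂ : ℝ) L)
    (hne : Nonempty (ι 0) ∨ Nonempty (ι 1) ∨ Nonempty (ι 2)) :
    S.OddEdgeVariationTypeTwo v w hvw ↔
      (Matrix.mulVec (L 0 0) 1 + Matrix.mulVec (L 0 1) 1 + (2 : ℝ) • Matrix.mulVec (L 0 2) 1
          = ((d₂ : ℝ) + 1) • (1 : ι 0 → ℝ)) ∧
      (Matrix.mulVec (L 1 0) 1 + Matrix.mulVec (L 1 1) 1 + (2 : ℝ) • Matrix.mulVec (L 1 2) 1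
          = ((d₁ : ℝ) + 1) • (1 : ι 1 → ℝ)) ∧
      (Matrix.mulVec (L 2 0) 1 + Matrix.mulVec (L 2 1) 1 + (2 : ℝ) • Matrix.mulVec (L 2 2) 1
          = ((d₁ : ℝ) + d₂ + 2) • (1 : ι 2 → ℝ)) ∧
      (Matrix.mulVec (L 3 0) 1 + Matrix.mulVec (L 3 1) 1 + (2 : ℝ) • Matrix.mulVec (L 3 2) 1
          = (-((d₁ : ℝ) - d₂)) • (1 : ι 3 → ℝ)) ∧
      (Matrix.mulVec (L 4 0) 1 + Matrix.mulVec (L 4 1) 1 + (2 : ℝ) • Matrix.mulVec (L 4 2) 1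
          = (0 : ι 4 → ℝ)) := by
  classical
  have hB : (centeredMatrix (d₁ : ℝ) d₂ L)ᵀ = centeredMatrix (d₁ : ℝ) d₂ L := by
    rw [← hL, transpose_reindex, S.laplacian_transpose]
  have hspec : S.spectrum = (centeredMatrix (d₁ : ℝ) d₂ L).charpoly.roots := by
    rw [SignedGraph.spectrum, ← hL, charpoly_reindex]
  have hspec' : (S.addOddEdge v w hvw).spectrum =
      (centeredMatrix (d₁ : ℝ) d₂ L +
        vecMulVec (Sum.elim 1 0) (Sum.elim 1 0)).charpoly.roots := by
    have hu (x : Fin 2 ⊕ (Σ k, ι k)) : (if e.symm x = v ∨ e.symm x = w then 1 else 0 : ℝ) =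
        (Sum.elim 1 0 : Fin 2 ⊕ (Σ k, ι k) → ℝ) x := by
      simp only [e.symm_apply_eq, hv, hw]
      obtain r | q := x
      · fin_cases r <;> simp
      · simp
    rw [SignedGraph.spectrum, ← charpoly_reindex e, S.laplacian_addOddEdge hvw hnonadj, ← hL]
    congr 2
    ext x y
    simp [vecMulVec_apply, hu]
  have hcount (i : V) : ∑ x, centeredMatrix (d₁ : ℝ) d₂ L (e i) x ^ 2 =
      (S.degree i : ℝ) ^ 2 + S.degree i := by
    rw [← S.sum_laplacian_sq, ← hL, ← e.sum_comp]
    simp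
  -- the degrees of `v` and `w` in terms of the block sizes
  have hc₁ : (d₁ : ℝ) = Fintype.card (ι 0) + Fintype.card (ι 2) + Fintype.card (ι 3) := by
    have := hcount v
    rw [hv, hd₁] at this
    simp [centeredMatrix, centeredRows, Fintype.sum_sigma, Fin.sum_univ_five] at this
    linarith
  have hc₂ : (d₂ : ℝ) = Fintype.card (ι 1) + Fintype.card (ι 2) + Fintype.card (ι 3) := by
    have := hcount w
    rw [hw, hd₂] at this
    simp [centeredMatrix, centeredRows, Fintype.sum_sigma, Fin.sum_univ_five] at this
    linarith
  have hu : (Sum.elim 1 0 : Fin 2 ⊕ (Σ k, ι k) → ℝ) ⬝ᵥ Sum.elim 1 0 = 2 := by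
    simp [dotProduct]
  have hm : (Sum.elim 1 0 : Fin 2 ⊕ (Σ k, ι k) → ℝ) ⬝ᵥ
      centeredMatrix (d₁ : ℝ) d₂ L *ᵥ Sum.elim 1 0 = d₁ + d₂ := by
    rw [centeredMatrix_mulVec]
    simp [dotProduct]
  rw [SignedGraph.OddEdgeVariationTypeTwo, hspec, hspec']
  constructor
  · rintro ⟨a, b, R, h, h'⟩
    obtain ⟨hq, hs⟩ :=
      mulVec_mulVec_eq_of_roots_charpoly_add_vecMulVec hB _ hu a b R h h'
    rw [hm] at hs
    rw [show a + b = (d₁ : ℝ) + d₂ + 1 by linarith] at hq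
    exact ((centeredMatrix_mulVec_mulVec_eq_iff _ _ _ L).1 hq).2
  · intro h
    -- the only value of `p` compatible with the rows of `v` and `w`; both give the same one
    set p : ℝ := d₁ * d₂ + Fintype.card (ι 3) - Fintype.card (ι 2) with hp
    have hq := (centeredMatrix_mulVec_mulVec_eq_iff (d₁ : ℝ) d₂ p L).2
      ⟨⟨by rw [hp]; linarith, by rw [hp]; linarith⟩, h⟩
    have hpos : (1 : ℝ) ≤ Fintype.card (ι 0) + Fintype.card (ι 1) + Fintype.card (ι 2) := by
      have : 1 ≤ Fintype.card (ι 0) + Fintype.card (ι 1) + Fintype.card (ι 2) := by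
        obtain h | h | h := hne <;> have := Fintype.card_pos_iff.2 h <;> omega
      exact_mod_cast this
    -- the discriminant is the square of the difference of the two eigenvalues; that one of the
    -- first three blocks is nonempty keeps them from differing by exactly `1`
    have hD : (1 : ℝ) < (d₁ + d₂ + 1) ^ 2 - 4 * p := by
      have h2 : (0 : ℝ) ≤ Fintype.card (ι 2) := Nat.cast_nonneg _
      have : ((d₁ : ℝ) + d₂ + 1) ^ 2 - 4 * p =
          ((d₁ : ℝ) - d₂) ^ 2 + 2 * (Fintype.card (ι 0) + Fintype.card (ι 1)) +
            8 * Fintype.card (ι 2) + 1 := by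
        rw [hp]
        linear_combination 2 * hc₁ + 2 * hc₂
      rw [this]
      have := sq_nonneg ((d₁ : ℝ) - d₂)
      linarith
    set r := Real.sqrt ((d₁ + d₂ + 1) ^ 2 - 4 * p)
    have hr : r ^ 2 = (d₁ + d₂ + 1) ^ 2 - 4 * p := Real.sq_sqrt (by linarith)
    have hr1 : 1 < r := by
      rw [Real.lt_sqrt zero_le_one]
      linarith
    refine ⟨((d₁ + d₂ + 1) + r) / 2, ((d₁ + d₂ + 1) - r) / 2,
      exists_roots_charpoly_add_vecMulVec _ hu _ _ ?_ ?_ ?_ ?_⟩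
    · intro h
      linarith
    · intro h
      linarith
    · rw [hq]
      congr 2
      · ring
      · linear_combination hr / 4
    · rw [hm]
      ring
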